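/- **Theorem (Noninterference for the Sealing Calculus).** Let $(\mathcal{L}, \sqsubseteq)$ be a partially ordered set of security levels. The *sealing calculus* over $\mathcal{L}$ is the simply typed $\lambda$-calculus with (possibly no) uninterpreted base types, a unit type, $\mathsf{Bool}$, products, coproducts and function types, extended with a type $[A]_\ell$ ("$A$ sealed at $\ell$") for each type $A$ and each $\ell \in \mathcal{L}$. Its typing judgements $\Gamma ; \pi \vdash M : A$ carry a finite set $\pi \subseteq \mathcal{L}$ of observer levels. Write $\ell \sqsubseteq \pi$ if $\ell \sqsubseteq k$ for some $k \in \pi$. The rules for sealed types are $$\frac{\Gamma ; \pi \cup \{\ell\} \vdash M : A}{\Gamma ; \pi \vdash [M]_\ell : [A]_\ell} \qquad\qquad \frac{\Gamma ; \pi \vdash M : [A]_\ell \quad \ell \sqsubseteq \pi}{\Gamma ; \pi \vdash M^\ell : A}$$ and all other rules are the usual ones for simple types, with $\pi$ held constant; in particular $\mathsf{tt}, \mathsf{ff} : \mathsf{Bool}$, and $\mathsf{if}\ M\ \mathsf{then}\ E_1\ \mathsf{else}\ E_0 : C$ whenever $M : \mathsf{Bool}$ and $E_0, E_1 : C$. The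 equality judgement $\Gamma ; \pi \vdash M = N : A$ is the least typed congruence containing the usual computation ($\beta$) rules for functions, products, coproducts and $\mathsf{Bool}$, together with $([M]_\ell)^\ell = M$ (where $\Gamma ; \pi \cup \{\ell\} \vdash M : A$ and $\ell \sqsubseteq \pi$). Let $A$ be a non-empty type, i.e. one for which there is a closed term of type $A$ at some finite set of observer levels. Let $\pi \subseteq \mathcal{L}$ be finite and let $\ell \in \mathcal{L}$ with $\ell \not\sqsubseteq \pi$. Then for all closed terms $\cdot\, ; \pi \vdash M : [A]_\ell$ and $\cdot\, ; \pi \vdash N : [A]_\ell$, and every term $x : [A]_\ell ; \pi \vdash E : \mathsf{Bool}$, we have $$\cdot\, ; \pi \vdash E[M/x] = E[N/x] : \mathsf{Bool}.$$ -/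

import Mathlib

/-!
The sealing calculus: the simply typed lambda-calculus (base types, unit, booleans, products,
coproducts, functions) over a partial order `L` of security levels, extended with sealed types.
Terms are raw terms with de Bruijn indices; typing and equality are judgements
`Γ ; π ⊢ M : A` and `Γ ; π ⊢ M = N : A`, where `π` is a finite set of observer levels.
-/

namespace SealingCalculus

universe u v

/-- Types. `B` is a set of names of uninterpreted base types, `L` the set of security levels. -/
inductive Ty (B : Type u) (L : Type v) : Type (max u v)
  | base (b : B)
  | unit
  | bool
  | prod (A C : Ty B L)
  | sum (A C : Ty B L)
  | arrow (A C : Ty B L)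
  /-- `sealed ℓ A` is the type `[A]_ℓ`. -/
  | sealed (ℓ : L) (A : Ty B L)

/-- Raw terms, with de Bruijn indices for variables and type annotations on binders and
injections. `sealAt ℓ M` is `[M]_ℓ`, and `unsealAt ℓ M` is `M^ℓ`. -/
inductive Tm (B : Type u) (L : Type v) : Type (max u v)
  | var (n : ℕ)
  | star
  | tt
  | ff
  /-- `ite M E₁ E₀` is `if M then E₁ else E₀`. -/
  | ite (M E₁ E₀ : Tm B L)
  | pair (M N : Tm B L)
  | fst (M : Tm B L)
  | snd (M : Tm B L)
  /-- `inl C M` is the left injection of `M` into a coproduct with right summand `C`. -/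
  | inl (C : Ty B L) (M : Tm B L)
  /-- `inr A M` is the right injection of `M` into a coproduct with left summand `A`. -/
  | inr (A : Ty B L) (M : Tm B L)
  /-- `caseOf M N₁ N₂` is case analysis on `M`; each of `N₁`, `N₂` binds one variable. -/
  | caseOf (M N₁ N₂ : Tm B L)
  /-- `lam A M` is `λ x : A. M`. -/
  | lam (A : Ty B L) (M : Tm B L)
  | app (M N : Tm B L)
  | sealAt (ℓ : L) (M : Tm B L)
  | unsealAt (ℓ : L) (M : Tm B L)

namespace Tm

variable {B : Type u} {L : Type v}

/-- Lifting of a renaming under one binder. -/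
def upRen (ρ : ℕ → ℕ) : ℕ → ℕ
  | 0 => 0
  | n + 1 => ρ n + 1

/-- Renaming of free variables. -/
def rename (ρ : ℕ → ℕ) : Tm B L → Tm B L
  | var n => var (ρ n)
  | star => star
  | tt => tt
  | ff => ff
  | ite M E₁ E₀ => ite (M.rename ρ) (E₁.rename ρ) (E₀.rename ρ)
  | pair M N => pair (M.rename ρ) (N.rename ρ)
  | fst M => fst (M.rename ρ)
  | snd M => snd (M.rename ρ)
  | inl C M => inl C (M.rename ρ)
  | inr A M => inr A (M.rename ρ)
  | caseOf M N₁ N₂ => caseOf (M.rename ρ) (N₁.rename (upRen ρ)) (N₂.rename (upRen ρ))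
  | lam A M => lam A (M.rename (upRen ρ))
  | app M N => app (M.rename ρ) (N.rename ρ)
  | sealAt ℓ M => sealAt ℓ (M.rename ρ)
  | unsealAt ℓ M => unsealAt ℓ (M.rename ρ)

/-- Lifting of a substitution under one binder. -/
def up (σ : ℕ → Tm B L) : ℕ → Tm B L
  | 0 => var 0
  | n + 1 => (σ n).rename Nat.succ

/-- Simultaneous capture-avoiding substitution. -/
def subst (σ : ℕ → Tm B L) : Tm B L → Tm B L
  | var n => σ n
  | star => star
  | tt => tt
  | ff => ff
  | ite M E₁ E₀ => ite (M.subst σ) (E₁.subst σ) (E₀.subst σ)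
  | pair M N => pair (M.subst σ) (N.subst σ)
  | fst M => fst (M.subst σ)
  | snd M => snd (M.subst σ)
  | inl C M => inl C (M.subst σ)
  | inr A M => inr A (M.subst σ)
  | caseOf M N₁ N₂ => caseOf (M.subst σ) (N₁.subst (up σ)) (N₂.subst (up σ))
  | lam A M => lam A (M.subst (up σ))
  | app M N => app (M.subst σ) (N.subst σ)
  | sealAt ℓ M => sealAt ℓ (M.subst σ)
  | unsealAt ℓ M => unsealAt ℓ (M.subst σ)

/-- The substitution that sends the variable `0` to `M` and lowers all other variables by one. -/
def single (M : Tm B L) : ℕ → Tm B L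
  | 0 => M
  | n + 1 => var n

/-- `E.inst M` is `E[M/x]`, where `x` is the most recently bound variable, of index `0`. -/
def inst (E M : Tm B L) : Tm B L :=
  E.subst (single M)

end Tm

/-- `ℓ ⊑ π`: the level `ℓ` is below some level of the finite set `π` of observer levels. -/
def Below {L : Type v} [PartialOrder L] (ℓ : L) (π : Finset L) : Prop :=
  ∃ k ∈ π, ℓ ≤ k

/-- The typing judgement `Γ ; π ⊢ M : A`. The head of the list `Γ` types the variable `0`. -/
inductive HasType {B : Type u} {L : Type v} [PartialOrder L] [DecidableEq L] :
    List (Ty B L) → Finset L → Tm B L → Ty B L → Prop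
  | var {Γ : List (Ty B L)} {π : Finset L} {n : ℕ} {A : Ty B L} :
      Γ[n]? = some A → HasType Γ π (.var n) A
  | star {Γ : List (Ty B L)} {π : Finset L} : HasType Γ π .star .unit
  | tt {Γ : List (Ty B L)} {π : Finset L} : HasType Γ π .tt .bool
  | ff {Γ : List (Ty B L)} {π : Finset L} : HasType Γ π .ff .bool
  | ite {Γ : List (Ty B L)} {π : Finset L} {M E₁ E₀ : Tm B L} {C : Ty B L} :
      HasType Γ π M .bool → HasType Γ π E₁ C → HasType Γ π E₀ C →
      HasType Γ π (.ite M E₁ E₀) C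
  | pair {Γ : List (Ty B L)} {π : Finset L} {M N : Tm B L} {A C : Ty B L} :
      HasType Γ π M A → HasType Γ π N C → HasType Γ π (.pair M N) (.prod A C)
  | fst {Γ : List (Ty B L)} {π : Finset L} {M : Tm B L} {A C : Ty B L} :
      HasType Γ π M (.prod A C) → HasType Γ π (.fst M) A
  | snd {Γ : List (Ty B L)} {π : Finset L} {M : Tm B L} {A C : Ty B L} :
      HasType Γ π M (.prod A C) → HasType Γ π (.snd M) C
  | inl {Γ : List (Ty B L)} {π : Finset L} {M : Tm B L} {A C : Ty B L} :
      HasType Γ π M A → HasType Γ π (.inl C M) (.sum A C)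
  | inr {Γ : List (Ty B L)} {π : Finset L} {M : Tm B L} {A C : Ty B L} :
      HasType Γ π M C → HasType Γ π (.inr A M) (.sum A C)
  | caseOf {Γ : List (Ty B L)} {π : Finset L} {M N₁ N₂ : Tm B L} {A C D : Ty B L} :
      HasType Γ π M (.sum A C) → HasType (A :: Γ) π N₁ D → HasType (C :: Γ) π N₂ D →
      HasType Γ π (.caseOf M N₁ N₂) D
  | lam {Γ : List (Ty B L)} {π : Finset L} {M : Tm B L} {A C : Ty B L} :
      HasType (A :: Γ) π M C → HasType Γ π (.lam A M) (.arrow A C)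
  | app {Γ : List (Ty B L)} {π : Finset L} {M N : Tm B L} {A C : Ty B L} :
      HasType Γ π M (.arrow A C) → HasType Γ π N A → HasType Γ π (.app M N) C
  | sealAt {Γ : List (Ty B L)} {π : Finset L} {ℓ : L} {M : Tm B L} {A : Ty B L} :
      HasType Γ (π ∪ {ℓ}) M A → HasType Γ π (.sealAt ℓ M) (.sealed ℓ A)
  | unsealAt {Γ : List (Ty B L)} {π : Finset L} {ℓ : L} {M : Tm B L} {A : Ty B L} :
      HasType Γ π M (.sealed ℓ A) → Below ℓ π → HasType Γ π (.unsealAt ℓ M) A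

/-- The equality judgement `Γ ; π ⊢ M = N : A`: the least typed congruence that contains the
computation rules of the calculus. No extensionality (`η`) laws are imposed, so this equality is
contained in the one that also has such laws. -/
inductive DefEq {B : Type u} {L : Type v} [PartialOrder L] [DecidableEq L] :
    List (Ty B L) → Finset L → Tm B L → Tm B L → Ty B L → Prop
  -- equivalence relation
  | refl {Γ : List (Ty B L)} {π : Finset L} {M : Tm B L} {A : Ty B L} :
      HasType Γ π M A → DefEq Γ π M M A
  | symm {Γ : List (Ty B L)} {π : Finset L} {M N : Tm B L} {A : Ty B L} :
      DefEq Γ π M N A → DefEq Γ π N M A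
  | trans {Γ : List (Ty B L)} {π : Finset L} {M N P : Tm B L} {A : Ty B L} :
      DefEq Γ π M N A → DefEq Γ π N P A → DefEq Γ π M P A
  -- congruence rules
  | ite {Γ : List (Ty B L)} {π : Finset L} {M M' E₁ E₁' E₀ E₀' : Tm B L} {C : Ty B L} :
      DefEq Γ π M M' .bool → DefEq Γ π E₁ E₁' C → DefEq Γ π E₀ E₀' C →
      DefEq Γ π (.ite M E₁ E₀) (.ite M' E₁' E₀') C
  | pair {Γ : List (Ty B L)} {π : Finset L} {M M' N N' : Tm B L} {A C : Ty B L} :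
      DefEq Γ π M M' A → DefEq Γ π N N' C → DefEq Γ π (.pair M N) (.pair M' N') (.prod A C)
  | fst {Γ : List (Ty B L)} {π : Finset L} {M M' : Tm B L} {A C : Ty B L} :
      DefEq Γ π M M' (.prod A C) → DefEq Γ π (.fst M) (.fst M') A
  | snd {Γ : List (Ty B L)} {π : Finset L} {M M' : Tm B L} {A C : Ty B L} :
      DefEq Γ π M M' (.prod A C) → DefEq Γ π (.snd M) (.snd M') C
  | inl {Γ : List (Ty B L)} {π : Finset L} {M M' : Tm B L} {A C : Ty B L} :
      DefEq Γ π M M' A → DefEq Γ π (.inl C M) (.inl C M') (.sum A C)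
  | inr {Γ : List (Ty B L)} {π : Finset L} {M M' : Tm B L} {A C : Ty B L} :
      DefEq Γ π M M' C → DefEq Γ π (.inr A M) (.inr A M') (.sum A C)
  | caseOf {Γ : List (Ty B L)} {π : Finset L} {M M' N₁ N₁' N₂ N₂' : Tm B L} {A C D : Ty B L} :
      DefEq Γ π M M' (.sum A C) → DefEq (A :: Γ) π N₁ N₁' D → DefEq (C :: Γ) π N₂ N₂' D →
      DefEq Γ π (.caseOf M N₁ N₂) (.caseOf M' N₁' N₂') D
  | lam {Γ : List (Ty B L)} {π : Finset L} {M M' : Tm B L} {A C : Ty B L} :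
      DefEq (A :: Γ) π M M' C → DefEq Γ π (.lam A M) (.lam A M') (.arrow A C)
  | app {Γ : List (Ty B L)} {π : Finset L} {M M' N N' : Tm B L} {A C : Ty B L} :
      DefEq Γ π M M' (.arrow A C) → DefEq Γ π N N' A → DefEq Γ π (.app M N) (.app M' N') C
  | sealAt {Γ : List (Ty B L)} {π : Finset L} {ℓ : L} {M M' : Tm B L} {A : Ty B L} :
      DefEq Γ (π ∪ {ℓ}) M M' A → DefEq Γ π (.sealAt ℓ M) (.sealAt ℓ M') (.sealed ℓ A)
  | unsealAt {Γ : List (Ty B L)} {π : Finset L} {ℓ : L} {M M' : Tm B L} {A : Ty B L} :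
      DefEq Γ π M M' (.sealed ℓ A) → Below ℓ π →
      DefEq Γ π (.unsealAt ℓ M) (.unsealAt ℓ M') A
  -- computation rules
  | ite_tt {Γ : List (Ty B L)} {π : Finset L} {E₁ E₀ : Tm B L} {C : Ty B L} :
      HasType Γ π E₁ C → HasType Γ π E₀ C → DefEq Γ π (.ite .tt E₁ E₀) E₁ C
  | ite_ff {Γ : List (Ty B L)} {π : Finset L} {E₁ E₀ : Tm B L} {C : Ty B L} :
      HasType Γ π E₁ C → HasType Γ π E₀ C → DefEq Γ π (.ite .ff E₁ E₀) E₀ C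
  | fst_pair {Γ : List (Ty B L)} {π : Finset L} {M N : Tm B L} {A C : Ty B L} :
      HasType Γ π M A → HasType Γ π N C → DefEq Γ π (.fst (.pair M N)) M A
  | snd_pair {Γ : List (Ty B L)} {π : Finset L} {M N : Tm B L} {A C : Ty B L} :
      HasType Γ π M A → HasType Γ π N C → DefEq Γ π (.snd (.pair M N)) N C
  | case_inl {Γ : List (Ty B L)} {π : Finset L} {M N₁ N₂ : Tm B L} {A C D : Ty B L} :
      HasType Γ π M A → HasType (A :: Γ) π N₁ D → HasType (C :: Γ) π N₂ D →
      DefEq Γ π (.caseOf (.inl C M) N₁ N₂) (N₁.inst M) D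
  | case_inr {Γ : List (Ty B L)} {π : Finset L} {M N₁ N₂ : Tm B L} {A C D : Ty B L} :
      HasType Γ π M C → HasType (A :: Γ) π N₁ D → HasType (C :: Γ) π N₂ D →
      DefEq Γ π (.caseOf (.inr A M) N₁ N₂) (N₂.inst M) D
  | app_lam {Γ : List (Ty B L)} {π : Finset L} {M N : Tm B L} {A C : Ty B L} :
      HasType (A :: Γ) π M C → HasType Γ π N A →
      DefEq Γ π (.app (.lam A M) N) (M.inst N) C
  | unseal_seal {Γ : List (Ty B L)} {π : Finset L} {ℓ : L} {M : Tm B L} {A : Ty B L} :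
      HasType Γ (π ∪ {ℓ}) M A → Below ℓ π →
      DefEq Γ π (.unsealAt ℓ (.sealAt ℓ M)) M A

/-- A type is non-empty if it has a closed term, at some set of observer levels. -/
def Ty.IsNonempty {B : Type u} {L : Type v} [PartialOrder L] [DecidableEq L]
    (A : Ty B L) : Prop :=
  ∃ (π : Finset L) (M : Tm B L), HasType [] π M A

end SealingCalculus

/-!
Noninterference is proved with a binary logical relation on closed terms, defined for a fixed set
`π` of observer levels: two booleans are related if they have a common value, and two terms of type
`[A]_ℓ` are related if they are so once unsealed, *provided `π` is allowed to unseal them*. Hence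
any two terms sealed at a level which is not below `π` are related. Every term maps related
substitutions to related terms, so `E[M/x]` and `E[N/x]` have the same boolean value.
-/

namespace SealingCalculus

namespace Tm

variable {B : Type*} {L : Type*}

theorem upRen_comp_upRen (ρ ρ' : ℕ → ℕ) : upRen ρ ∘ upRen ρ' = upRen (ρ ∘ ρ') := by
  funext n
  cases n <;> rfl

theorem rename_rename (M : Tm B L) (ρ ρ' : ℕ → ℕ) :
    (M.rename ρ').rename ρ = M.rename (ρ ∘ ρ') := by
  induction M generalizing ρ ρ' <;> simp_all [rename, upRen_comp_upRen]

theorem up_comp_upRen (σ : ℕ → Tm B L) (ρ : ℕ → ℕ) : up σ ∘ upRen ρ = up (σ ∘ ρ) := by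
  funext n
  cases n <;> rfl

theorem subst_rename (M : Tm B L) (σ : ℕ → Tm B L) (ρ : ℕ → ℕ) :
    (M.rename ρ).subst σ = M.subst (σ ∘ ρ) := by
  induction M generalizing σ ρ <;> simp_all [rename, subst, up_comp_upRen]

theorem rename_upRen_comp_up (ρ : ℕ → ℕ) (σ : ℕ → Tm B L) :
    rename (upRen ρ) ∘ up σ = up (rename ρ ∘ σ) := by
  funext n
  cases n with
  | zero => rfl
  | succ n =>
    calc ((σ n).rename Nat.succ).rename (upRen ρ)
        = (σ n).rename (upRen ρ ∘ Nat.succ) := rename_rename ..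
      _ = (σ n).rename (Nat.succ ∘ ρ) := rfl
      _ = ((σ n).rename ρ).rename Nat.succ := (rename_rename ..).symm

theorem rename_subst (M : Tm B L) (σ : ℕ → Tm B L) (ρ : ℕ → ℕ) :
    (M.subst σ).rename ρ = M.subst (rename ρ ∘ σ) := by
  induction M generalizing σ ρ <;> simp_all [rename, subst, rename_upRen_comp_up]

theorem subst_up_comp_up (τ σ : ℕ → Tm B L) : subst (up τ) ∘ up σ = up (subst τ ∘ σ) := by
  funext n
  cases n with
  | zero => rfl
  | succ n =>
    calc ((σ n).rename Nat.succ).subst (up τ)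
        = (σ n).subst (up τ ∘ Nat.succ) := subst_rename ..
      _ = (σ n).subst (rename Nat.succ ∘ τ) := rfl
      _ = ((σ n).subst τ).rename Nat.succ := (rename_subst ..).symm

theorem subst_subst (M : Tm B L) (σ τ : ℕ → Tm B L) :
    (M.subst σ).subst τ = M.subst (subst τ ∘ σ) := by
  induction M generalizing σ τ <;> simp_all [subst, subst_up_comp_up]

theorem up_var : up (var : ℕ → Tm B L) = var := by
  funext n
  cases n <;> rfl

theorem subst_var (M : Tm B L) : M.subst var = M := by
  induction M <;> simp_all [subst, up_var]

/-- Extension of a substitution: the variable `0` is sent to `P` and the variable `n + 1` to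
`σ n`. It extends a closing substitution past a binder, as opposed to `up`. -/
def cons (P : Tm B L) (σ : ℕ → Tm B L) : ℕ → Tm B L
  | 0 => P
  | n + 1 => σ n

theorem single_eq_cons_var (P : Tm B L) : single P = cons P var := by
  funext n
  cases n <;> rfl

theorem inst_subst_up (M P : Tm B L) (σ : ℕ → Tm B L) :
    (M.subst (up σ)).inst P = M.subst (cons P σ) := by
  have single_comp_up : subst (single P) ∘ up σ = cons P σ := by
    funext n
    cases n with
    | zero => rfl
    | succ n => exact (subst_rename ..).trans (subst_var (σ n))
  rw [inst, subst_subst, single_comp_up]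

end Tm

section Observers

variable {L : Type*} [PartialOrder L] {π π' : Finset L} {ℓ : L}

theorem Below.of_isCofinalFor (hℓ : Below ℓ π) (h : IsCofinalFor (π : Set L) π') : Below ℓ π' := by
  obtain ⟨k, hk, hℓk⟩ := hℓ
  obtain ⟨j, hj, hkj⟩ := h hk
  exact ⟨j, hj, hℓk.trans hkj⟩

variable [DecidableEq L]

theorem isCofinalFor_union_singleton_left (h : IsCofinalFor (π : Set L) π') (hℓ : Below ℓ π') :
    IsCofinalFor ((π ∪ {ℓ} : Finset L) : Set L) π' := by
  intro k hk
  rcases Finset.mem_union.1 hk with hk | hk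
  · exact h hk
  · rwa [Finset.mem_singleton.1 hk]

theorem isCofinalFor_union_singleton (h : IsCofinalFor (π : Set L) π') (ℓ : L) :
    IsCofinalFor ((π ∪ {ℓ} : Finset L) : Set L) (π' ∪ {ℓ} : Finset L) :=
  isCofinalFor_union_singleton_left
    (h.mono_right (Finset.coe_subset.2 Finset.subset_union_left))
    ⟨ℓ, Finset.mem_union_right _ (Finset.mem_singleton_self ℓ), le_rfl⟩

end Observers

variable {B : Type*} {L : Type*}

/-- `ρ` is a well-typed renaming from the context `Γ` to the context `Δ`. -/
def TypedRenaming (Γ Δ : List (Ty B L)) (ρ : ℕ → ℕ) : Prop :=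
  ∀ n A, Γ[n]? = some A → Δ[ρ n]? = some A

theorem TypedRenaming.upRen {Γ Δ : List (Ty B L)} {ρ : ℕ → ℕ} (h : TypedRenaming Γ Δ ρ)
    (C : Ty B L) : TypedRenaming (C :: Γ) (C :: Δ) (Tm.upRen ρ)
  | 0, _, hn => hn
  | n + 1, A, hn => h n A hn

variable [PartialOrder L] [DecidableEq L] {Γ Δ : List (Ty B L)} {π π' : Finset L}
  {A C D : Ty B L} {ℓ : L} {M M' N N' N₁ N₁' N₂ N₂' E₁ E₁' E₀ E₀' P P' : Tm B L}
  {σ σ' : ℕ → Tm B L}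

theorem HasType.mono (hM : HasType Γ π M A) (h : IsCofinalFor (π : Set L) π') :
    HasType Γ π' M A := by
  induction hM generalizing π' with
  | var hn => exact .var hn
  | star => exact .star
  | tt => exact .tt
  | ff => exact .ff
  | ite _ _ _ ih ih₁ ih₀ => exact .ite (ih h) (ih₁ h) (ih₀ h)
  | pair _ _ ih ih' => exact .pair (ih h) (ih' h)
  | fst _ ih => exact .fst (ih h)
  | snd _ ih => exact .snd (ih h)
  | inl _ ih => exact .inl (ih h)
  | inr _ ih => exact .inr (ih h)
  | caseOf _ _ _ ih ih₁ ih₂ => exact .caseOf (ih h) (ih₁ h) (ih₂ h)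
  | lam _ ih => exact .lam (ih h)
  | app _ _ ih ih' => exact .app (ih h) (ih' h)
  | sealAt _ ih => exact .sealAt (ih (isCofinalFor_union_singleton h _))
  | unsealAt _ hℓ ih => exact .unsealAt (ih h) (hℓ.of_isCofinalFor h)

theorem HasType.rename {ρ : ℕ → ℕ} (hM : HasType Γ π M A) (h : TypedRenaming Γ Δ ρ) :
    HasType Δ π (M.rename ρ) A := by
  induction hM generalizing Δ ρ with
  | var hn => exact .var (h _ _ hn)
  | star => exact .star
  | tt => exact .tt
  | ff => exact .ff
  | ite _ _ _ ih ih₁ ih₀ => exact .ite (ih h) (ih₁ h) (ih₀ h)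
  | pair _ _ ih ih' => exact .pair (ih h) (ih' h)
  | fst _ ih => exact .fst (ih h)
  | snd _ ih => exact .snd (ih h)
  | inl _ ih => exact .inl (ih h)
  | inr _ ih => exact .inr (ih h)
  | caseOf _ _ _ ih ih₁ ih₂ => exact .caseOf (ih h) (ih₁ (h.upRen _)) (ih₂ (h.upRen _))
  | lam _ ih => exact .lam (ih (h.upRen _))
  | app _ _ ih ih' => exact .app (ih h) (ih' h)
  | sealAt _ ih => exact .sealAt (ih h)
  | unsealAt _ hℓ ih => exact .unsealAt (ih h) hℓ

/-- `σ` is a well-typed substitution from the context `Γ` to the context `Δ`, for the observer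
levels `π`. -/
def TypedSubst (Γ Δ : List (Ty B L)) (π : Finset L) (σ : ℕ → Tm B L) : Prop :=
  ∀ n A, Γ[n]? = some A → HasType Δ π (σ n) A

theorem TypedSubst.up (h : TypedSubst Γ Δ π σ) (C : Ty B L) :
    TypedSubst (C :: Γ) (C :: Δ) π (Tm.up σ)
  | 0, _, hn => .var hn
  | n + 1, A, hn => (h n A hn).rename fun _ _ => id

theorem TypedSubst.mono (hσ : TypedSubst Γ Δ π σ) (h : IsCofinalFor (π : Set L) π') :
    TypedSubst Γ Δ π' σ :=
  fun n A hn => (hσ n A hn).mono h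

theorem TypedSubst.union_singleton (hσ : TypedSubst Γ Δ π σ) (ℓ : L) :
    TypedSubst Γ Δ (π ∪ {ℓ}) σ :=
  hσ.mono (.of_subset (Finset.coe_subset.2 Finset.subset_union_left))

theorem TypedSubst.var : TypedSubst Γ Γ π Tm.var :=
  fun _ _ => .var

theorem TypedSubst.cons (hP : HasType Δ π P A) (h : TypedSubst Γ Δ π σ) :
    TypedSubst (A :: Γ) Δ π (Tm.cons P σ)
  | 0, _, hn => Option.some.inj hn ▸ hP
  | n + 1, A, hn => h n A hn

theorem HasType.subst (hM : HasType Γ π M A) (h : TypedSubst Γ Δ π σ) :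
    HasType Δ π (M.subst σ) A := by
  induction hM generalizing Δ σ with
  | var hn => exact h _ _ hn
  | star => exact .star
  | tt => exact .tt
  | ff => exact .ff
  | ite _ _ _ ih ih₁ ih₀ => exact .ite (ih h) (ih₁ h) (ih₀ h)
  | pair _ _ ih ih' => exact .pair (ih h) (ih' h)
  | fst _ ih => exact .fst (ih h)
  | snd _ ih => exact .snd (ih h)
  | inl _ ih => exact .inl (ih h)
  | inr _ ih => exact .inr (ih h)
  | caseOf _ _ _ ih ih₁ ih₂ => exact .caseOf (ih h) (ih₁ (h.up _)) (ih₂ (h.up _))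
  | lam _ ih => exact .lam (ih (h.up _))
  | app _ _ ih ih' => exact .app (ih h) (ih' h)
  | sealAt _ ih => exact .sealAt (ih (h.union_singleton _))
  | unsealAt _ hℓ ih => exact .unsealAt (ih h) hℓ

theorem HasType.inst (hM : HasType (A :: Γ) π M C) (hP : HasType Γ π P A) :
    HasType Γ π (M.inst P) C := by
  rw [Tm.inst, Tm.single_eq_cons_var]
  exact hM.subst (.cons hP .var)

theorem DefEq.hasType (h : DefEq Γ π M N A) : HasType Γ π M A ∧ HasType Γ π N A := by
  induction h with
  | refl hM => exact ⟨hM, hM⟩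
  | symm _ ih => exact ih.symm
  | trans _ _ ih ih' => exact ⟨ih.1, ih'.2⟩
  | ite _ _ _ ih ih₁ ih₀ => exact ⟨.ite ih.1 ih₁.1 ih₀.1, .ite ih.2 ih₁.2 ih₀.2⟩
  | pair _ _ ih ih' => exact ⟨.pair ih.1 ih'.1, .pair ih.2 ih'.2⟩
  | fst _ ih => exact ⟨.fst ih.1, .fst ih.2⟩
  | snd _ ih => exact ⟨.snd ih.1, .snd ih.2⟩
  | inl _ ih => exact ⟨.inl ih.1, .inl ih.2⟩
  | inr _ ih => exact ⟨.inr ih.1, .inr ih.2⟩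
  | caseOf _ _ _ ih ih₁ ih₂ => exact ⟨.caseOf ih.1 ih₁.1 ih₂.1, .caseOf ih.2 ih₁.2 ih₂.2⟩
  | lam _ ih => exact ⟨.lam ih.1, .lam ih.2⟩
  | app _ _ ih ih' => exact ⟨.app ih.1 ih'.1, .app ih.2 ih'.2⟩
  | sealAt _ ih => exact ⟨.sealAt ih.1, .sealAt ih.2⟩
  | unsealAt _ hℓ ih => exact ⟨.unsealAt ih.1 hℓ, .unsealAt ih.2 hℓ⟩
  | ite_tt h₁ h₀ => exact ⟨.ite .tt h₁ h₀, h₁⟩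
  | ite_ff h₁ h₀ => exact ⟨.ite .ff h₁ h₀, h₀⟩
  | fst_pair hM hN => exact ⟨.fst (.pair hM hN), hM⟩
  | snd_pair hM hN => exact ⟨.snd (.pair hM hN), hN⟩
  | case_inl hM h₁ h₂ => exact ⟨.caseOf (.inl hM) h₁ h₂, h₁.inst hM⟩
  | case_inr hM h₁ h₂ => exact ⟨.caseOf (.inr hM) h₁ h₂, h₂.inst hM⟩
  | app_lam hM hN => exact ⟨.app (.lam hM) hN, hM.inst hN⟩
  | unseal_seal hM hℓ =>
    exact ⟨.unsealAt (.sealAt hM) hℓ, hM.mono (isCofinalFor_union_singleton_left .rfl hℓ)⟩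

theorem DefEq.ite_of_eq_tt (hM : DefEq Γ π M .tt .bool) (h₁ : HasType Γ π E₁ C)
    (h₀ : HasType Γ π E₀ C) : DefEq Γ π (.ite M E₁ E₀) E₁ C :=
  (hM.ite (.refl h₁) (.refl h₀)).trans (.ite_tt h₁ h₀)

theorem DefEq.ite_of_eq_ff (hM : DefEq Γ π M .ff .bool) (h₁ : HasType Γ π E₁ C)
    (h₀ : HasType Γ π E₀ C) : DefEq Γ π (.ite M E₁ E₀) E₀ C :=
  (hM.ite (.refl h₁) (.refl h₀)).trans (.ite_ff h₁ h₀)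

theorem DefEq.caseOf_of_eq_inl (hM : DefEq Γ π M (.inl C P) (.sum A C))
    (h₁ : HasType (A :: Γ) π N₁ D) (h₂ : HasType (C :: Γ) π N₂ D) :
    DefEq Γ π (.caseOf M N₁ N₂) (N₁.inst P) D := by
  cases hM.hasType.2 with
  | inl hP => exact (hM.caseOf (.refl h₁) (.refl h₂)).trans (.case_inl hP h₁ h₂)

theorem DefEq.caseOf_of_eq_inr (hM : DefEq Γ π M (.inr A P) (.sum A C))
    (h₁ : HasType (A :: Γ) π N₁ D) (h₂ : HasType (C :: Γ) π N₂ D) :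
    DefEq Γ π (.caseOf M N₁ N₂) (N₂.inst P) D := by
  cases hM.hasType.2 with
  | inr hP => exact (hM.caseOf (.refl h₁) (.refl h₂)).trans (.case_inr hP h₁ h₂)

/-- Indistinguishability of closed terms of type `A` for an observer at the levels `π`: a logical
relation, closed under definitional equality, which imposes no condition beyond typing on terms
sealed at a level that `π` cannot unseal. At base types and the unit type it is trivial too, since
the calculus has no eliminator for them. -/
def Indist (π : Finset L) (A : Ty B L) (M M' : Tm B L) : Prop :=
  HasType [] π M A ∧ HasType [] π M' A ∧
    match A with
    | .base _ => True
    | .unit => True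
    | .bool =>
      (DefEq [] π M .tt .bool ∧ DefEq [] π M' .tt .bool) ∨
        (DefEq [] π M .ff .bool ∧ DefEq [] π M' .ff .bool)
    | .prod A C => Indist π A (.fst M) (.fst M') ∧ Indist π C (.snd M) (.snd M')
    | .sum A C =>
      (∃ P P', Indist π A P P' ∧
        DefEq [] π M (.inl C P) (.sum A C) ∧ DefEq [] π M' (.inl C P') (.sum A C)) ∨
      (∃ P P', Indist π C P P' ∧
        DefEq [] π M (.inr A P) (.sum A C) ∧ DefEq [] π M' (.inr A P') (.sum A C))
    | .arrow A C => ∀ P P', Indist π A P P' → Indist π C (.app M P) (.app M' P')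
    | .sealed ℓ A => Below ℓ π → Indist π A (.unsealAt ℓ M) (.unsealAt ℓ M')

namespace Indist

theorem left (h : Indist π A M M') : HasType [] π M A := by
  rw [Indist.eq_def] at h
  exact h.1

theorem right (h : Indist π A M M') : HasType [] π M' A := by
  rw [Indist.eq_def] at h
  exact h.2.1

theorem of_defEq {A : Ty B L} {M M' N N' : Tm B L} (h : Indist π A N N')
    (e : DefEq [] π M N A) (e' : DefEq [] π M' N' A) : Indist π A M M' :=
  match A with
  | .base _ | .unit => ⟨e.hasType.1, e'.hasType.1, trivial⟩
  | .bool =>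
    ⟨e.hasType.1, e'.hasType.1, h.2.2.imp (.imp e.trans e'.trans) (.imp e.trans e'.trans)⟩
  | .prod _ _ =>
    ⟨e.hasType.1, e'.hasType.1, of_defEq h.2.2.1 e.fst e'.fst, of_defEq h.2.2.2 e.snd e'.snd⟩
  | .sum _ _ =>
    ⟨e.hasType.1, e'.hasType.1, h.2.2.imp
      (fun ⟨P, P', hP, f, f'⟩ => ⟨P, P', hP, e.trans f, e'.trans f'⟩)
      (fun ⟨P, P', hP, f, f'⟩ => ⟨P, P', hP, e.trans f, e'.trans f'⟩)⟩
  | .arrow _ _ =>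
    ⟨e.hasType.1, e'.hasType.1, fun P P' hP =>
      of_defEq (h.2.2 P P' hP) (e.app (.refl hP.left)) (e'.app (.refl hP.right))⟩
  | .sealed _ _ =>
    ⟨e.hasType.1, e'.hasType.1, fun hℓ =>
      of_defEq (h.2.2 hℓ) (e.unsealAt hℓ) (e'.unsealAt hℓ)⟩

theorem defEq_of_bool (h : Indist π .bool M M') : DefEq [] π M M' .bool := by
  rcases h.2.2 with ⟨e, e'⟩ | ⟨e, e'⟩
  · exact e.trans e'.symm
  · exact e.trans e'.symm

theorem of_not_below (hℓ : ¬ Below ℓ π) (hM : HasType [] π M (.sealed ℓ A))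
    (hN : HasType [] π N (.sealed ℓ A)) : Indist π (.sealed ℓ A) M N :=
  ⟨hM, hN, fun h => absurd h hℓ⟩

theorem ite (h : Indist π .bool M M') (h₁ : Indist π C E₁ E₁') (h₀ : Indist π C E₀ E₀') :
    Indist π C (.ite M E₁ E₀) (.ite M' E₁' E₀') := by
  rcases h.2.2 with ⟨e, e'⟩ | ⟨e, e'⟩
  · exact h₁.of_defEq (e.ite_of_eq_tt h₁.left h₀.left) (e'.ite_of_eq_tt h₁.right h₀.right)
  · exact h₀.of_defEq (e.ite_of_eq_ff h₁.left h₀.left) (e'.ite_of_eq_ff h₁.right h₀.right)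

theorem pair (h₁ : Indist π A M M') (h₂ : Indist π C N N') :
    Indist π (.prod A C) (.pair M N) (.pair M' N') :=
  ⟨.pair h₁.left h₂.left, .pair h₁.right h₂.right,
    h₁.of_defEq (.fst_pair h₁.left h₂.left) (.fst_pair h₁.right h₂.right),
    h₂.of_defEq (.snd_pair h₁.left h₂.left) (.snd_pair h₁.right h₂.right)⟩

theorem fst (h : Indist π (.prod A C) M M') : Indist π A (.fst M) (.fst M') :=
  h.2.2.1

theorem snd (h : Indist π (.prod A C) M M') : Indist π C (.snd M) (.snd M') :=
  h.2.2.2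

theorem inl (h : Indist π A M M') : Indist π (.sum A C) (.inl C M) (.inl C M') :=
  ⟨.inl h.left, .inl h.right,
    .inl ⟨M, M', h, .refl (.inl h.left), .refl (.inl h.right)⟩⟩

theorem inr (h : Indist π C M M') : Indist π (.sum A C) (.inr A M) (.inr A M') :=
  ⟨.inr h.left, .inr h.right,
    .inr ⟨M, M', h, .refl (.inr h.left), .refl (.inr h.right)⟩⟩

theorem app (h : Indist π (.arrow A C) M M') (hP : Indist π A P P') :
    Indist π C (.app M P) (.app M' P') :=
  h.2.2 P P' hP

theorem sealAt (hM : HasType [] (π ∪ {ℓ}) M A) (hM' : HasType [] (π ∪ {ℓ}) M' A)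
    (h : Below ℓ π → Indist π A M M') :
    Indist π (.sealed ℓ A) (.sealAt ℓ M) (.sealAt ℓ M') :=
  ⟨.sealAt hM, .sealAt hM', fun hℓ =>
    (h hℓ).of_defEq (.unseal_seal hM hℓ) (.unseal_seal hM' hℓ)⟩

theorem unsealAt (h : Indist π (.sealed ℓ A) M M') (hℓ : Below ℓ π) :
    Indist π A (.unsealAt ℓ M) (.unsealAt ℓ M') :=
  h.2.2 hℓ

end Indist

/-- Indistinguishability of terms of type `C` with one free variable of type `A`, as they occur
under a binder: they take indistinguishable arguments to indistinguishable instances. -/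
structure IndistUnder (π : Finset L) (A C : Ty B L) (M M' : Tm B L) : Prop where
  left : HasType [A] π M C
  right : HasType [A] π M' C
  inst : ∀ {P P'}, Indist π A P P' → Indist π C (M.inst P) (M'.inst P')

theorem Indist.lam (h : IndistUnder π A C M M') :
    Indist π (.arrow A C) (.lam A M) (.lam A M') :=
  ⟨.lam h.left, .lam h.right, fun _ _ hP =>
    (h.inst hP).of_defEq (.app_lam h.left hP.left) (.app_lam h.right hP.right)⟩

theorem Indist.caseOf (h : Indist π (.sum A C) M M') (h₁ : IndistUnder π A D N₁ N₁')
    (h₂ : IndistUnder π C D N₂ N₂') :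
    Indist π D (.caseOf M N₁ N₂) (.caseOf M' N₁' N₂') := by
  rcases h.2.2 with ⟨P, P', hP, e, e'⟩ | ⟨P, P', hP, e, e'⟩
  · exact (h₁.inst hP).of_defEq (e.caseOf_of_eq_inl h₁.left h₂.left)
      (e'.caseOf_of_eq_inl h₁.right h₂.right)
  · exact (h₂.inst hP).of_defEq (e.caseOf_of_eq_inr h₁.left h₂.left)
      (e'.caseOf_of_eq_inr h₁.right h₂.right)

/-- Pointwise indistinguishability of two substitutions of closed terms for the variables
of `Γ`. -/
def SubstIndist (Γ : List (Ty B L)) (π : Finset L) (σ σ' : ℕ → Tm B L) : Prop :=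
  ∀ n A, Γ[n]? = some A → Indist π A (σ n) (σ' n)

namespace SubstIndist

theorem left (h : SubstIndist Γ π σ σ') : TypedSubst Γ [] π σ :=
  fun n A hn => (h n A hn).left

theorem right (h : SubstIndist Γ π σ σ') : TypedSubst Γ [] π σ' :=
  fun n A hn => (h n A hn).right

theorem cons (hP : Indist π A P P') (h : SubstIndist Γ π σ σ') :
    SubstIndist (A :: Γ) π (Tm.cons P σ) (Tm.cons P' σ')
  | 0, _, hn => Option.some.inj hn ▸ hP
  | n + 1, A, hn => h n A hn

theorem indistUnder (h : SubstIndist Γ π σ σ') (hM : HasType (A :: Γ) π M C)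
    (ih : ∀ {τ τ'}, SubstIndist (A :: Γ) π τ τ' → Indist π C (M.subst τ) (M.subst τ')) :
    IndistUnder π A C (M.subst (Tm.up σ)) (M.subst (Tm.up σ')) where
  left := hM.subst (h.left.up A)
  right := hM.subst (h.right.up A)
  inst hP := by
    rw [Tm.inst_subst_up, Tm.inst_subst_up]
    exact ih (h.cons hP)

end SubstIndist

/-- The fundamental lemma of the logical relation. In the induction `π'` varies while `π` stays
fixed: the content of a seal is typed with one more observer level, which is absorbed by `π` in the
only case where the relation inspects that content. -/
theorem HasType.indist_subst (hM : HasType Γ π' M A) (hπ : IsCofinalFor (π' : Set L) π)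
    (hσ : SubstIndist Γ π σ σ') : Indist π A (M.subst σ) (M.subst σ') := by
  induction hM generalizing σ σ' with
  | var hn => exact hσ _ _ hn
  | star => exact ⟨.star, .star, trivial⟩
  | tt => exact ⟨.tt, .tt, .inl ⟨.refl .tt, .refl .tt⟩⟩
  | ff => exact ⟨.ff, .ff, .inr ⟨.refl .ff, .refl .ff⟩⟩
  | ite _ _ _ ih ih₁ ih₀ => exact .ite (ih hπ hσ) (ih₁ hπ hσ) (ih₀ hπ hσ)
  | pair _ _ ih ih' => exact .pair (ih hπ hσ) (ih' hπ hσ)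
  | fst _ ih => exact .fst (ih hπ hσ)
  | snd _ ih => exact .snd (ih hπ hσ)
  | inl _ ih => exact .inl (ih hπ hσ)
  | inr _ ih => exact .inr (ih hπ hσ)
  | caseOf _ h₁ h₂ ih ih₁ ih₂ =>
    exact .caseOf (ih hπ hσ) (hσ.indistUnder (h₁.mono hπ) (ih₁ hπ))
      (hσ.indistUnder (h₂.mono hπ) (ih₂ hπ))
  | lam h ih => exact .lam (hσ.indistUnder (h.mono hπ) (ih hπ))
  | app _ _ ih ih' => exact .app (ih hπ hσ) (ih' hπ hσ)
  | sealAt h ih =>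
    have h := h.mono (isCofinalFor_union_singleton hπ _)
    exact .sealAt (h.subst (hσ.left.union_singleton _)) (h.subst (hσ.right.union_singleton _))
      fun hℓ => ih (isCofinalFor_union_singleton_left hπ hℓ) hσ
  | unsealAt _ hℓ ih => exact .unsealAt (ih hπ hσ) (hℓ.of_isCofinalFor hπ)

theorem HasType.indist_inst (hM : HasType [A] π M C) (hP : Indist π A P P') :
    Indist π C (M.inst P) (M.inst P') := by
  rw [Tm.inst, Tm.inst, Tm.single_eq_cons_var, Tm.single_eq_cons_var]
  exact hM.indist_subst .rfl (.cons hP fun _ _ hn => nomatch hn)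

end SealingCalculus

theorem mainTheorem8 {B : Type*} {L : Type*} [PartialOrder L] [DecidableEq L]
    (A : SealingCalculus.Ty B L) (hA : A.IsNonempty)
    (ℓ : L) (π : Finset L) (hℓ : ¬ SealingCalculus.Below ℓ π)
    (M N E : SealingCalculus.Tm B L)
    (hM : SealingCalculus.HasType [] π M (.sealed ℓ A))
    (hN : SealingCalculus.HasType [] π N (.sealed ℓ A))
    (hE : SealingCalculus.HasType [.sealed ℓ A] π E .bool) :
    SealingCalculus.DefEq [] π (E.inst M) (E.inst N) .bool :=
  (hE.indist_inst (.of_not_below hℓ hM hN)).defEq_of_bool
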